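/- All graphs are finite and undirected; loops and multiple edges are allowed unless stated otherwise. For a graph $G=(V,E)$ and edge weights $\mathbf v=\{v_e\}_{e\in E}$, the multivariate Tutte polynomial is $$Z_G(q,\mathbf v)=\sum_{A\subseteq E} q^{k(A)}\prod_{e\in A}v_e,$$ where $k(A)$ is the number of connected components of the subgraph $(V,A)$. For distinct vertices $x,y$ let $\lambda_G(x,y)$ be the maximum number of pairwise edge-disjoint paths from $x$ to $y$; the maxmaxflow of $G$ is $\Lambda(G)=\max_{x\neq y}\lambda_G(x,y)$ (and $0$ if $G$ has at most one vertex). A loopless graph is series-parallel if it can be obtained from a forest by a finite (possibly empty) sequence of series and parallel extensions of edges, i.e. of replacements of an edge by two edges in series or by two edges in parallel. Theorem. Fix an integer $\Lambda\ge 2$. Let $G=(V,E)$ be a loopless series-parallel graph of maxmaxflow at most $\Lambda$, and let the edge weights $\mathbf v=\{v_e\}_{e\in E}$ be real with $v_e\in[-1,0]$ for all $e\in E$. Then all the roots $q$ (real or complex) of the multivariate Tutte polynomial $Z_G(q,\mathbf v)$ lie in the disc $$|q-1|<\frac{\Lambda-1}{\log 2},$$ where $\log$ denotes the natural logarithm.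 -/

import Mathlib

open scoped Graph

namespace Graph

/-! Graphs are Mathlib's multigraphs `Graph α β` (loops and multiple edges allowed), with vertex set
`V(G)`, edge set `E(G)`, and `G.IsLink e x y` saying that the edge `e` has ends `x` and `y`. -/

/-- `G.IsWalk x p y`: `p` is a walk in `G` from `x` to `y`, given as the list of its steps,
where the step `(e, z)` traverses the edge `e` and arrives at the vertex `z`. -/
inductive IsWalk {α β : Type*} (G : Graph α β) : α → List (β × α) → α → Prop
  | nil {x : α} (hx : x ∈ V(G)) : IsWalk G x [] x
  | cons {x z y : α} {e : β} {p : List (β × α)} (h : G.IsLink e x z) (hp : IsWalk G z p y) :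
      IsWalk G x ((e, z) :: p) y

/-- The list of edges traversed by a walk. -/
def walkEdges {α β : Type*} (p : List (β × α)) : List β := p.map Prod.fst

/-- The list of vertices at which the steps of a walk arrive (all vertices but the first one). -/
def walkTail {α β : Type*} (p : List (β × α)) : List α := p.map Prod.snd

/-- A path is a walk whose vertices are pairwise distinct. -/
def IsPath {α β : Type*} (G : Graph α β) (x : α) (p : List (β × α)) (y : α) : Prop :=
  G.IsWalk x p y ∧ (x :: walkTail p).Nodup

/-- A cycle is a closed walk of positive length with distinct edges and with distinct vertices
(apart from the coincidence of the first and the last one). A loop is a cycle of length 1 and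
a pair of parallel edges is a cycle of length 2. -/
def IsCycle {α β : Type*} (G : Graph α β) (x : α) (p : List (β × α)) : Prop :=
  G.IsWalk x p x ∧ p ≠ [] ∧ (walkEdges p).Nodup ∧ (walkTail p).Nodup

/-- A forest is a graph without cycles. -/
def IsForest {α β : Type*} (G : Graph α β) : Prop := ∀ x p, ¬ G.IsCycle x p

/-- `H` arises from `G` by replacing an edge `e` by two edges in parallel; one of these two
edges is again called `e`, the other one is a new edge `f`. -/
def IsParallelExtension {α β : Type*} (G H : Graph α β) : Prop :=
  ∃ e ∈ E(G), ∃ f ∉ E(G), V(H) = V(G) ∧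
    ∀ i a b, H.IsLink i a b ↔ G.IsLink i a b ∨ (i = f ∧ G.IsLink e a b)

/-- `H` arises from `G` by replacing an edge `e`, with ends `x` and `y`, by two edges in series:
an edge from `x` to a new vertex `w`, which is again called `e`, and a new edge `f`
from `w` to `y`. -/
def IsSeriesExtension {α β : Type*} (G H : Graph α β) : Prop :=
  ∃ e x y, G.IsLink e x y ∧ ∃ f ∉ E(G), ∃ w ∉ V(G), V(H) = insert w V(G) ∧
    ∀ i a b, H.IsLink i a b ↔
      (i ≠ e ∧ G.IsLink i a b) ∨ (i = e ∧ s(a, b) = s(x, w)) ∨ (i = f ∧ s(a, b) = s(w, y))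

/-- The graphs obtained from a forest by a finite (possibly empty) sequence of series and parallel
extensions of edges. They are loopless. -/
inductive FromForest {α β : Type*} : Graph α β → Prop
  | forest {G : Graph α β} (hG : G.IsForest) : FromForest G
  | parallel {G H : Graph α β} (hG : FromForest G) (h : G.IsParallelExtension H) : FromForest H
  | series {G H : Graph α β} (hG : FromForest G) (h : G.IsSeriesExtension H) : FromForest H

/-- A graph is series-parallel if its underlying loopless graph (all loops deleted) can be obtained
from a forest by a finite sequence of series and parallel extensions of edges. -/
def IsSeriesParallel {α β : Type*} (G : Graph α β) : Prop :=
  (G.deleteEdges {e | ∃ x, G.IsLoopAt e x}).FromForest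

/-- `λ_G(x, y)`: the maximum number of pairwise edge-disjoint paths from `x` to `y`
(meaningful for `x ≠ y`). -/
noncomputable def maxFlow {α β : Type*} (G : Graph α β) (x y : α) : ℕ∞ :=
  ⨆ (k : ℕ) (_ : ∃ P : Fin k → List (β × α), (∀ i, G.IsPath x (P i) y) ∧
    Pairwise fun i j => (walkEdges (P i)).Disjoint (walkEdges (P j))), (k : ℕ∞)

/-- The maxmaxflow `Λ(G)`: the maximum of `λ_G(x, y)` over all pairs of distinct vertices. -/
noncomputable def maxMaxFlow {α β : Type*} (G : Graph α β) : ℕ∞ :=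
  ⨆ (x ∈ V(G)) (y ∈ V(G)) (_ : x ≠ y), G.maxFlow x y

/-- The number of connected components, i.e. of classes of the equivalence relation on `V(G)`
generated by adjacency (`Quot` is the quotient by the generated equivalence relation). -/
noncomputable def numComponents {α β : Type*} (G : Graph α β) : ℕ :=
  Nat.card (Quot fun x y : V(G) => G.Adj x y)

/-- The multivariate Tutte polynomial `Z_G(q, v) = ∑_{A ⊆ E} q ^ k(A) ∏_{e ∈ A} v_e`, where `k(A)`
is the number of connected components of the subgraph `(V, A)`. -/
noncomputable def multivariateTutte {α β : Type*} (G : Graph α β) (hE : E(G).Finite)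
    (q : ℂ) (v : β → ℂ) : ℂ :=
  ∑ A ∈ hE.toFinset.powerset, q ^ (G.restrict (A : Set β)).numComponents * ∏ e ∈ A, v e

end Graph

namespace Graph

/-! ### Transmissivity regions -/

/-! Undo the series and parallel extensions one at a time. Two parallel edges of weights `u`, `v`
merge into one of weight `u + v + u * v`; two series edges merge into one of weight `u * v / (q + u
+ v)`, at the cost of the factor `q + u + v`. In a forest every edge is a bridge and contributes a
factor `(q + v e) / q`, so it suffices that no factor met on the way vanishes.

With the transmissivity `t = v / (q + v)`, series composition multiplies the `t`'s, while parallel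
composition multiplies the numbers `1 + v = (1 + (q - 1) * t) / (1 - t)`. Put `r = 1 / ‖q - 1‖` and
`m = Λ - 1`. If `‖t‖ ≤ r` on both edges, a series reduction gives at most `r ^ 2` (`series_mem`).
Parallel composition of `c` such branches is worst for `q - 1 = -1 / r` and `t = -r ^ 2`, where `1 +
v` becomes `growth r ^ c`; this gives `radius r c` (`parallel_mem`), which is at most `r` as long as
`growth r ^ c * (1 + r) ≤ 2`. As `growth r` is roughly `exp r`, the condition `r * m ≤ log 2`
ensures this for all `c ≤ m` (`growth_pow_bound`). Original weights in `[-1, 0]` only scale `1 + v`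
by a factor in `[0, 1]`, which is harmless (`weightDisc_scale`).

The flow bound limits `c`: an edge standing for `c` disjoint connections of the original graph with
`c ≥ Λ` must be a bridge, since one more connection would exceed `Λ` (`CarriedBy.not_conn`). Such an
edge is split off as a nonzero factor instead of being composed further. -/

/-- The multiplicative growth, per branch, of the extremal parallel composition. -/
noncomputable def growth (r : ℝ) : ℝ := (1 + r) / (1 + r ^ 2)

/-- The bound on the transmissivity of a parallel composition of `c` branches,
each of transmissivity at most `r ^ 2`. -/
noncomputable def radius (r : ℝ) (c : ℕ) : ℝ := r * (growth r ^ c - 1) / (1 - r * growth r ^ c)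

/-- Effective weights of parallel compositions of `c` branches: `1 + v` is a factor in `[0, 1]`
times the value belonging to a transmissivity `t` of modulus at most `radius r c`. -/
def weightRegion (q : ℂ) (c : ℕ) : Set ℂ :=
  {v | ∃ x : ℝ, 0 ≤ x ∧ x ≤ 1 ∧ ∃ t : ℂ, ‖t‖ ≤ radius ‖q - 1‖⁻¹ c ∧
    (1 + v) * (1 - t) = x * (1 + (q - 1) * t)}

/-- Weights whose transmissivity `t = v / (q + v)` has modulus at most `1 / ‖q - 1‖`. -/
def weightDisc (q : ℂ) : Set ℂ := {v | ∃ t : ℂ, ‖t‖ ≤ ‖q - 1‖⁻¹ ∧ v * (1 - t) = q * t}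

section Analysis

variable {r : ℝ} {c a b m : ℕ} {q u v : ℂ}

/-! ### Real estimates for `growth` and `radius`. -/

lemma one_le_growth (h0 : 0 < r) (h1 : r < 1) : 1 ≤ growth r := by
  rw [growth, one_le_div (by positivity)]
  nlinarith

lemma mul_growth_pow_lt_one (h0 : 0 < r) (h1 : r < 1) (h : growth r ^ c * (1 + r) ≤ 2) :
    r * growth r ^ c < 1 := by
  have h2 : (1 : ℝ) ≤ growth r ^ c := one_le_pow₀ (one_le_growth h0 h1)
  nlinarith

lemma radius_nonneg (h0 : 0 < r) (h1 : r < 1) (h : growth r ^ c * (1 + r) ≤ 2) :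
    0 ≤ radius r c := by
  have h2 : (1 : ℝ) ≤ growth r ^ c := one_le_pow₀ (one_le_growth h0 h1)
  have h3 := mul_growth_pow_lt_one h0 h1 h
  exact div_nonneg (mul_nonneg h0.le (by linarith)) (by linarith)

lemma radius_le (h0 : 0 < r) (h1 : r < 1) (h : growth r ^ c * (1 + r) ≤ 2) :
    radius r c ≤ r := by
  have h3 := mul_growth_pow_lt_one h0 h1 h
  rw [radius, div_le_iff₀ (by linarith)]
  nlinarith

/-- Equality holds at `c = 1`: `growth r` is the value of `1 + v` at `t = -r ^ 2`, `q - 1 = -1 / r`.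
-/
lemma sq_le_radius (h0 : 0 < r) (h1 : r < 1) (h : growth r ^ c * (1 + r) ≤ 2) (hc : 1 ≤ c) :
    r ^ 2 ≤ radius r c := by
  have h3 := mul_growth_pow_lt_one h0 h1 h
  have h4 : growth r ≤ growth r ^ c := le_self_pow₀ (one_le_growth h0 h1) (by omega)
  have h5 : 1 + r ≤ growth r ^ c * (1 + r ^ 2) := by
    rw [growth, div_le_iff₀ (by positivity)] at h4
    exact h4
  rw [radius, le_div_iff₀ (by linarith)]
  nlinarith

/-- For `ρ = radius r c` one has `(1 + ρ / r) / (1 + ρ) = growth r ^ c`, which is multiplicative in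
`c`. The left side is, up to sign, the parallel composition of `-radius r a` and `-radius r b` at `q
- 1 = -1 / r`. -/
lemma radius_parallel (h0 : 0 < r) (h1 : r < 1) (h : growth r ^ (a + b) * (1 + r) ≤ 2) :
    (radius r a + radius r b + (r⁻¹ + 1) * (radius r a * radius r b)) /
      (1 - r⁻¹ * (radius r a * radius r b)) = radius r (a + b) := by
  have h2 : (1 : ℝ) ≤ growth r ^ a := one_le_pow₀ (one_le_growth h0 h1)
  have h2' : (1 : ℝ) ≤ growth r ^ b := one_le_pow₀ (one_le_growth h0 h1)
  have h3 := mul_growth_pow_lt_one h0 h1 h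
  unfold radius
  rw [pow_add] at *
  set A := growth r ^ a
  set B := growth r ^ b
  have ha : 0 < 1 - r * A := by nlinarith [mul_nonneg h0.le (by linarith : (0 : ℝ) ≤ A)]
  have hb : 0 < 1 - r * B := by nlinarith [mul_nonneg h0.le (by linarith : (0 : ℝ) ≤ B)]
  have hab : 0 < 1 - r * (A * B) := by linarith
  have hd : 1 - r⁻¹ * (r * (A - 1) / (1 - r * A) * (r * (B - 1) / (1 - r * B))) =
      (1 - r) * (1 - r * (A * B)) / ((1 - r * A) * (1 - r * B)) := by
    field_simp
    ring
  have hn : r * (A - 1) / (1 - r * A) + r * (B - 1) / (1 - r * B) +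
      (r⁻¹ + 1) * (r * (A - 1) / (1 - r * A) * (r * (B - 1) / (1 - r * B))) =
      (1 - r) * (r * (A * B - 1)) / ((1 - r * A) * (1 - r * B)) := by
    field_simp
    ring
  rw [hd, hn]
  have h4 : 1 - r ≠ 0 := by linarith
  field_simp

lemma growth_pow_anti (h0 : 0 < r) (h1 : r < 1) (hab : a ≤ b)
    (h : growth r ^ b * (1 + r) ≤ 2) : growth r ^ a * (1 + r) ≤ 2 :=
  le_trans (mul_le_mul_of_nonneg_right (pow_le_pow_right₀ (one_le_growth h0 h1) hab)
    (by linarith)) h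

lemma growth_pow_bound (h0 : 0 < r) (hm : 1 ≤ m) (h : r * m ≤ Real.log 2) :
    growth r ^ m * (1 + r) ≤ 2 := by
  have hl1 := Real.log_two_gt_d9
  have hl2 := Real.log_two_lt_d9
  -- For `m = 1` the claim is `(1 - r) ^ 2 ≥ 0`; for `m ≥ 2`, `r` is small enough for Taylor bounds.
  rcases hm.eq_or_lt with rfl | hm
  · rw [growth, pow_one, div_mul_eq_mul_div, div_le_iff₀ (by positivity)]
    nlinarith [sq_nonneg (1 - r)]
  have hm' : (2 : ℝ) ≤ m := by exact_mod_cast hm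
  have hr : r ≤ 0.35 := by nlinarith
  have e1 : Real.log (1 + r) ≤ r - r ^ 2 / 2 + r ^ 3 / 3 := by
    rw [Real.log_le_iff_le_exp (by positivity)]
    have hs : 0 ≤ r - r ^ 2 / 2 + r ^ 3 / 3 := by nlinarith [pow_pos h0 3]
    refine le_trans ?_ (Real.sum_le_exp_of_nonneg hs 4)
    simp only [Finset.sum_range_succ, Finset.sum_range_zero, Nat.factorial]
    have hr2 : r ^ 2 ≤ 1 := by nlinarith
    have hr4 : r ^ 4 ≤ 1 := by nlinarith [sq_nonneg r]
    have hfac : 0 ≤ 5 / 24 + r / 8 - 19 / 144 * r ^ 2 + 7 / 72 * r ^ 3 - r ^ 4 / 36 +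
        r ^ 5 / 162 := by
      linarith [pow_pos h0 3, pow_pos h0 5]
    have := mul_nonneg (pow_pos h0 4).le hfac
    norm_num
    linarith
  have e2 : r ^ 2 - r ^ 4 / 2 ≤ Real.log (1 + r ^ 2) := by
    refine le_trans ?_ (Real.le_log_one_add_of_nonneg (sq_nonneg r))
    rw [le_div_iff₀ (by positivity)]
    nlinarith [pow_pos h0 6]
  have hgpos : 0 < growth r := by unfold growth; positivity
  have hg : 0 ≤ Real.log (growth r) := Real.log_nonneg (one_le_growth h0 (by linarith))
  have e3 : Real.log (growth r) = Real.log (1 + r) - Real.log (1 + r ^ 2) :=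
    Real.log_div (by positivity) (by positivity)
  rw [← Real.log_le_log_iff (by positivity) (by norm_num),
    Real.log_mul (by positivity) (by positivity), Real.log_pow]
  -- The goal is multiplied by `r`, so that `r * m ≤ log 2` eliminates `m`.
  have e4 : r * (m * Real.log (growth r)) ≤ Real.log 2 * Real.log (growth r) := by
    nlinarith
  have e5 : Real.log 2 * Real.log (growth r) + r * Real.log (1 + r) ≤ r * Real.log 2 := by
    rw [e3]
    have : (Real.log 2 + r) * Real.log (1 + r) ≤
      (Real.log 2 + r) * (r - r ^ 2 / 2 + r ^ 3 / 3) := by gcongr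
    have : Real.log 2 * (r ^ 2 - r ^ 4 / 2) ≤ Real.log 2 * Real.log (1 + r ^ 2) := by gcongr
    -- After the Taylor bounds, `r ^ 2` times this expression remains. Its constant term is negative
    -- because `log 2 > 2 / 3`; it is convex in `r` and still negative at `0.35`.
    have key : (1 - 3 / 2 * Real.log 2) + r * (Real.log 2 / 3 - 1 / 2) +
        r ^ 2 * (1 / 3 + Real.log 2 / 2) ≤ 0 := by nlinarith
    nlinarith [mul_nonneg (sq_nonneg r) (neg_nonneg.2 key)]
  nlinarith

/-! ### Regions of effective weights under scaling, series and parallel composition. -/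

lemma weightDisc_iff (hq : 1 < ‖q - 1‖) :
    v ∈ weightDisc q ↔ q + v ≠ 0 ∧ ‖v‖ ≤ ‖q - 1‖⁻¹ * ‖q + v‖ := by
  have hq0 : q ≠ 0 := by rintro rfl; simp at hq
  have hr : ‖q - 1‖⁻¹ < 1 := inv_lt_one_of_one_lt₀ hq
  constructor
  · rintro ⟨t, ht, h⟩
    have ht1 : 1 - t ≠ 0 := fun h0 => by
      have : t = 1 := by linear_combination -h0
      rw [this] at ht
      simp at ht
      linarith
    have hv : (q + v) * (1 - t) = q := by linear_combination h
    have h0 : q + v ≠ 0 := fun h0 => hq0 (by rw [← hv, h0, zero_mul])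
    refine ⟨h0, ?_⟩
    have : v = t * (q + v) := by linear_combination h
    calc ‖v‖ = ‖t‖ * ‖q + v‖ := by rw [← norm_mul, ← this]
      _ ≤ _ := by gcongr
  · rintro ⟨h0, h⟩
    refine ⟨v / (q + v), ?_, ?_⟩
    · rw [norm_div]
      exact div_le_of_le_mul₀ (norm_nonneg _) (by positivity) h
    · field_simp
      ring

lemma add_ne_zero_of_mem_weightDisc (hq : 1 < ‖q - 1‖) (hv : v ∈ weightDisc q) : q + v ≠ 0 :=
  ((weightDisc_iff hq).1 hv).1

lemma one_sub_ne_zero {t : ℂ} (ht : ‖t‖ < 1) : 1 - t ≠ 0 := fun h0 => by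
  have : t = 1 := by linear_combination -h0
  simp [this] at ht

/-- `weightDisc q` is a genuine disc whose boundary passes through `-1`, so by convexity it is
stable under contraction towards `-1`. -/
lemma weightDisc_scale (hq : 1 < ‖q - 1‖) (hu : u ∈ weightDisc q) {x : ℝ} (hx0 : 0 ≤ x)
    (hx1 : x ≤ 1) (hv : 1 + v = x * (1 + u)) : v ∈ weightDisc q := by
  rw [weightDisc_iff hq] at *
  have hq0 : 0 < ‖q - 1‖ := by linarith
  -- In the coordinate `1 + w` the inequality has a quadratic and a linear part but no constant
  -- term, so scaling by `x ≤ 1` preserves it.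
  have key : ∀ w : ℂ, ‖w‖ ≤ ‖q - 1‖⁻¹ * ‖q + w‖ ↔
      (Complex.normSq (q - 1) - 1) * Complex.normSq (1 + w) ≤
        2 * (Complex.normSq (q - 1) * (1 + w.re) +
          ((q.re - 1) * (1 + w.re) + q.im * w.im)) := by
    intro w
    rw [inv_mul_eq_div, le_div_iff₀ hq0, ← abs_of_nonneg (norm_nonneg (q + w)),
      ← abs_of_nonneg (by positivity : 0 ≤ ‖w‖ * ‖q - 1‖), ← sq_le_sq, mul_pow,
      ← Complex.normSq_eq_norm_sq, ← Complex.normSq_eq_norm_sq, ← Complex.normSq_eq_norm_sq]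
    simp only [Complex.normSq_apply, Complex.add_re, Complex.add_im, Complex.sub_re,
      Complex.sub_im, Complex.one_re, Complex.one_im]
    constructor <;> intro h <;> nlinarith
  have hQ : 1 < Complex.normSq (q - 1) := by
    rw [Complex.normSq_eq_norm_sq]; nlinarith
  have h2 := (key u).1 hu.2
  have hre : 1 + v.re = x * (1 + u.re) := by simpa using congrArg Complex.re hv
  have him : v.im = x * u.im := by simpa using congrArg Complex.im hv
  have h3 : ‖v‖ ≤ ‖q - 1‖⁻¹ * ‖q + v‖ := by
    rw [key, hv, hre, him, Complex.normSq_mul, Complex.normSq_ofReal]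
    have hT := le_trans (mul_nonneg (by linarith) (Complex.normSq_nonneg (1 + u))) h2
    have hxx : 0 ≤ x * (1 - x) := mul_nonneg hx0 (by linarith)
    nlinarith [mul_le_mul_of_nonneg_left h2 (mul_nonneg hx0 hx0), mul_nonneg hxx hT]
  refine ⟨fun h0 => ?_, h3⟩
  rw [h0, norm_zero, mul_zero] at h3
  have hv0 : v = 0 := norm_le_zero_iff.1 h3
  rw [hv0, add_zero] at h0
  simp [h0] at hq

lemma mem_weightDisc_of_mem_weightRegion (hq : 1 < ‖q - 1‖)
    (hc : growth ‖q - 1‖⁻¹ ^ c * (1 + ‖q - 1‖⁻¹) ≤ 2) (hv : v ∈ weightRegion q c) :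
    v ∈ weightDisc q := by
  obtain ⟨x, hx0, hx1, t, ht, h⟩ := hv
  have hr : ‖q - 1‖⁻¹ < 1 := inv_lt_one_of_one_lt₀ hq
  have ht' := ht.trans (radius_le (by positivity) hr hc)
  have ht1 : 1 - t ≠ 0 := one_sub_ne_zero (by linarith)
  refine weightDisc_scale (u := q * t / (1 - t)) hq ⟨t, ht', by field_simp⟩ hx0 hx1 ?_
  field_simp
  linear_combination h

lemma mem_weightRegion_of_mem_Icc {x : ℝ} (hq : 1 < ‖q - 1‖)
    (hc : growth ‖q - 1‖⁻¹ ^ c * (1 + ‖q - 1‖⁻¹) ≤ 2) (hx : x ∈ Set.Icc (-1 : ℝ) 0) :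
    (x : ℂ) ∈ weightRegion q c :=
  ⟨1 + x, by linarith [hx.1], by linarith [hx.2], 0, by
    simpa using radius_nonneg (by positivity) (inv_lt_one_of_one_lt₀ hq) hc, by push_cast; ring⟩

lemma norm_mul_lt_one_of_le {t s : ℂ} (hq : 1 < ‖q - 1‖) (ht : ‖t‖ ≤ ‖q - 1‖⁻¹)
    (hs : ‖s‖ ≤ ‖q - 1‖⁻¹) : ‖(q - 1) * (t * s)‖ < 1 := by
  have hq0 : 0 < ‖q - 1‖ := by linarith
  calc ‖(q - 1) * (t * s)‖ = ‖q - 1‖ * (‖t‖ * ‖s‖) := by simp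
    _ ≤ ‖q - 1‖ * (‖q - 1‖⁻¹ * ‖q - 1‖⁻¹) := by gcongr
    _ = ‖q - 1‖⁻¹ := by field_simp
    _ < 1 := inv_lt_one_of_one_lt₀ hq

/-- Needed for the bridge factor, where the number of branches may be too large for `weightRegion`.
The expression equals `q * (1 + (q - 1) * (t * s)) / ((1 - t) * (1 - s))`. -/
lemma add_add_mul_ne_zero (hq : 1 < ‖q - 1‖) (hu : u ∈ weightDisc q) (hv : v ∈ weightDisc q) :
    q + (u + v + u * v) ≠ 0 := by
  obtain ⟨t, ht, h⟩ := hu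
  obtain ⟨s, hs, h'⟩ := hv
  have hq0 : q ≠ 0 := by rintro rfl; simp at hq
  have hts := norm_mul_lt_one_of_le hq ht hs
  intro h0
  have e : (q + (u + v + u * v)) * ((1 - t) * (1 - s)) = q * (1 + (q - 1) * (t * s)) := by
    linear_combination (1 - s + v * (1 - s)) * h + (1 - t + q * t) * h'
  rw [h0, zero_mul, eq_comm, mul_eq_zero, or_iff_right hq0] at e
  have : (q - 1) * (t * s) = -1 := by linear_combination e
  simp [this] at hts

/-- The new transmissivity is `t * s`, of modulus at most `r ^ 2`; this fits every `c ≥ 1`. -/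
lemma series_mem (hq : 1 < ‖q - 1‖) (hc : growth ‖q - 1‖⁻¹ ^ c * (1 + ‖q - 1‖⁻¹) ≤ 2)
    (hc1 : 1 ≤ c) (hu : u ∈ weightDisc q) (hv : v ∈ weightDisc q) :
    q + u + v ≠ 0 ∧ u * v / (q + u + v) ∈ weightRegion q c := by
  obtain ⟨t, ht, h⟩ := hu
  obtain ⟨s, hs, h'⟩ := hv
  have hq0 : q ≠ 0 := by rintro rfl; simp at hq
  have hr : ‖q - 1‖⁻¹ < 1 := inv_lt_one_of_one_lt₀ hq
  have hr0 : 0 < ‖q - 1‖⁻¹ := by positivity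
  have hts : ‖t * s‖ ≤ ‖q - 1‖⁻¹ ^ 2 := by
    rw [norm_mul, sq]; gcongr
  have hts1 : 1 - t * s ≠ 0 := one_sub_ne_zero (by nlinarith)
  have ht1 : 1 - t ≠ 0 := one_sub_ne_zero (by linarith)
  have hs1 : 1 - s ≠ 0 := one_sub_ne_zero (by linarith)
  have hu' : u = q * t / (1 - t) := by field_simp; exact h
  have hv' : v = q * s / (1 - s) := by field_simp; exact h'
  have e : q + u + v = q * (1 - t * s) / ((1 - t) * (1 - s)) := by
    rw [hu', hv']; field_simp; ring
  have e' : u * v / (q + u + v) = q * (t * s) / (1 - t * s) := by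
    rw [e, hu', hv']; field_simp
  refine ⟨by rw [e]; positivity, 1, by norm_num, le_rfl, t * s,
    hts.trans (sq_le_radius hr0 hr hc hc1), ?_⟩
  rw [e']
  field_simp
  push_cast
  ring

/-- The scaling factors multiply separately, and the triangle inequality bounds the combined
transmissivity by the extremal value of `radius_parallel`. -/
lemma parallel_mem (hq : 1 < ‖q - 1‖)
    (hc : growth ‖q - 1‖⁻¹ ^ (a + b) * (1 + ‖q - 1‖⁻¹) ≤ 2)
    (hu : u ∈ weightRegion q a) (hv : v ∈ weightRegion q b) :
    u + v + u * v ∈ weightRegion q (a + b) := by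
  obtain ⟨x, hx0, hx1, t, ht, h⟩ := hu
  obtain ⟨y, hy0, hy1, s, hs, h'⟩ := hv
  have hr : ‖q - 1‖⁻¹ < 1 := inv_lt_one_of_one_lt₀ hq
  have hr0 : 0 < ‖q - 1‖⁻¹ := by positivity
  have hca := growth_pow_anti hr0 hr (Nat.le_add_right a b) hc
  have hcb := growth_pow_anti hr0 hr (Nat.le_add_left b a) hc
  have hta := ht.trans (radius_le hr0 hr hca)
  have hsb := hs.trans (radius_le hr0 hr hcb)
  have hts := norm_mul_lt_one_of_le hq hta hsb
  have hden : 1 + (q - 1) * (t * s) ≠ 0 := by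
    simpa using one_sub_ne_zero (t := -((q - 1) * (t * s))) (by simpa using hts)
  refine ⟨x * y, by positivity, mul_le_one₀ hx1 hy0 hy1,
    (t + s + (q - 2) * (t * s)) / (1 + (q - 1) * (t * s)), ?_, ?_⟩
  · rw [← radius_parallel hr0 hr hc, norm_div, inv_inv]
    have hra := radius_nonneg hr0 hr hca
    have hrb := radius_nonneg hr0 hr hcb
    have hla := radius_le hr0 hr hca
    have hlb := radius_le hr0 hr hcb
    have hq0 : 0 < ‖q - 1‖ := by linarith
    have hab : ‖t‖ * ‖s‖ ≤ radius ‖q - 1‖⁻¹ a * radius ‖q - 1‖⁻¹ b := by gcongr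
    have hlt : ‖q - 1‖ * (radius ‖q - 1‖⁻¹ a * radius ‖q - 1‖⁻¹ b) < 1 := by
      calc _ ≤ ‖q - 1‖ * (‖q - 1‖⁻¹ * ‖q - 1‖⁻¹) := by gcongr
        _ = ‖q - 1‖⁻¹ := by field_simp
        _ < 1 := hr
    have hnum : ‖t + s + (q - 2) * (t * s)‖ ≤
        ‖t‖ + ‖s‖ + (‖q - 1‖ + 1) * (‖t‖ * ‖s‖) := by
      refine (norm_add₃_le ..).trans ?_
      have : ‖q - 2‖ ≤ ‖q - 1‖ + 1 := by
        have := norm_sub_le (q - 1) 1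
        rw [norm_one] at this
        calc ‖q - 2‖ = ‖q - 1 - 1‖ := by congr 1; ring
          _ ≤ _ := this
      rw [norm_mul, norm_mul]
      gcongr
    have hd : 1 - ‖q - 1‖ * (‖t‖ * ‖s‖) ≤ ‖1 + (q - 1) * (t * s)‖ := by
      have := norm_sub_le (1 + (q - 1) * (t * s)) ((q - 1) * (t * s))
      rw [add_sub_cancel_right, norm_one, norm_mul, norm_mul] at this
      linarith
    refine div_le_div₀ (by positivity) (hnum.trans (by gcongr)) (by linarith) (le_trans ?_ hd)
    nlinarith
  · have e1 : 1 - (t + s + (q - 2) * (t * s)) / (1 + (q - 1) * (t * s)) =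
        (1 - t) * (1 - s) / (1 + (q - 1) * (t * s)) := by
      rw [eq_div_iff hden, sub_mul, div_mul_cancel₀ _ hden]
      ring
    have e2 : 1 + (q - 1) * ((t + s + (q - 2) * (t * s)) / (1 + (q - 1) * (t * s))) =
        (1 + (q - 1) * t) * (1 + (q - 1) * s) / (1 + (q - 1) * (t * s)) := by
      rw [eq_div_iff hden, add_mul, mul_assoc (q - 1), div_mul_cancel₀ _ hden]
      ring
    rw [e1, e2, mul_div_assoc', mul_div_assoc']
    congr 1
    push_cast
    linear_combination (1 + v) * (1 - s) * h + x * (1 + (q - 1) * t) * h'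

end Analysis

/-! ### Counting connected components -/

section Quot

variable {X Y : Type*}

/-- Identifying two distinct points of a finite type lowers its cardinality by one. -/
lemma card_quot_pair [Finite X] {x y : X} (hxy : x ≠ y) :
    Nat.card (Quot fun a b : X => a = x ∧ b = y) + 1 = Nat.card X := by
  classical
  have e : Quot (fun a b : X => a = x ∧ b = y) ≃ {a : X // a ≠ y} :=
    { toFun := Quot.lift (fun a => if h : a = y then ⟨x, hxy⟩ else ⟨a, h⟩) (by
        rintro a b ⟨rfl, rfl⟩
        simp [hxy])
      invFun := fun a => Quot.mk _ a.1
      left_inv := by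
        rintro ⟨a⟩
        by_cases h : a = y
        · subst h
          simpa using Quot.sound (r := fun a b : X => a = x ∧ b = _) ⟨rfl, rfl⟩
        · simp [h]
      right_inv := by
        rintro ⟨a, h⟩
        simp [h] }
  have := Fintype.ofFinite X
  rw [Nat.card_congr e, Nat.card_eq_fintype_card, Nat.card_eq_fintype_card,
    Fintype.card_subtype_compl, Fintype.card_subtype_eq]
  have : 0 < Fintype.card X := Fintype.card_pos_iff.2 ⟨x⟩
  omega

/-- Adding a pair to a relation is identifying two points of its quotient. -/
def quotInsertEquiv (r r' : X → X → Prop) (x y : X)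
    (h : ∀ a b, r' a b ↔ r a b ∨ (a = x ∧ b = y) ∨ (a = y ∧ b = x)) :
    Quot r' ≃ Quot fun a b : Quot r => a = Quot.mk r x ∧ b = Quot.mk r y where
  toFun := Quot.lift (fun a => Quot.mk _ (Quot.mk r a)) (by
    intro a b hab
    rcases (h a b).1 hab with hab | ⟨rfl, rfl⟩ | ⟨rfl, rfl⟩
    · rw [Quot.sound hab]
    · exact Quot.sound ⟨rfl, rfl⟩
    · exact (Quot.sound ⟨rfl, rfl⟩).symm)
  invFun := Quot.lift (Quot.lift (fun a => Quot.mk r' a)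
      fun a b hab => Quot.sound ((h a b).2 (Or.inl hab))) (by
    rintro _ _ ⟨rfl, rfl⟩
    exact Quot.sound ((h x y).2 (Or.inr (Or.inl ⟨rfl, rfl⟩))))
  left_inv := by rintro ⟨a⟩; rfl
  right_inv := by rintro ⟨⟨a⟩⟩; rfl

lemma card_quot_insert_of_ne [Finite X] {r r' : X → X → Prop} {x y : X}
    (h : ∀ a b, r' a b ↔ r a b ∨ (a = x ∧ b = y) ∨ (a = y ∧ b = x))
    (hxy : Quot.mk r x ≠ Quot.mk r y) : Nat.card (Quot r') + 1 = Nat.card (Quot r) := by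
  rw [Nat.card_congr (quotInsertEquiv r r' x y h), card_quot_pair hxy]

lemma card_quot_insert_of_eq {r r' : X → X → Prop} {x y : X}
    (h : ∀ a b, r' a b ↔ r a b ∨ (a = x ∧ b = y) ∨ (a = y ∧ b = x))
    (hxy : Quot.mk r x = Quot.mk r y) : Nat.card (Quot r') = Nat.card (Quot r) := by
  rw [Nat.card_congr (quotInsertEquiv r r' x y h)]
  refine Nat.card_congr
    { toFun := Quot.lift id (by rintro _ _ ⟨rfl, rfl⟩; exact hxy)
      invFun := Quot.mk _
      left_inv := by rintro ⟨a⟩; rfl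
      right_inv := fun a => rfl }

end Quot

variable {α β : Type*} {G H : Graph α β}

/-- `a` and `b` are equal or joined by a walk whose edges are in `S`. -/
def Conn (G : Graph α β) (S : Set β) : α → α → Prop :=
  Relation.EqvGen fun a b => ∃ e ∈ S, G.IsLink e a b

lemma Conn.refl (G : Graph α β) (S : Set β) (a : α) : G.Conn S a a := Relation.EqvGen.refl a

lemma Conn.symm {S : Set β} {a b : α} (h : G.Conn S a b) : G.Conn S b a :=
  Relation.EqvGen.symm _ _ h

lemma Conn.trans {S : Set β} {a b c : α} (h : G.Conn S a b) (h' : G.Conn S b c) :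
    G.Conn S a c := Relation.EqvGen.trans _ _ _ h h'

lemma IsLink.conn {S : Set β} {e : β} {a b : α} (h : G.IsLink e a b) (he : e ∈ S) :
    G.Conn S a b := Relation.EqvGen.rel _ _ ⟨e, he, h⟩

/-- A map sending the links of `G` in `S` to connected pairs preserves connectedness. -/
lemma Conn.map {α' β' : Type*} {H : Graph α' β'} {S : Set β} {T : Set β'} {a b : α}
    (h : G.Conn S a b) (φ : α → α')
    (hφ : ∀ e ∈ S, ∀ x y, G.IsLink e x y → H.Conn T (φ x) (φ y)) : H.Conn T (φ a) (φ b) := by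
  induction h with
  | rel x y h => obtain ⟨e, he, h⟩ := h; exact hφ e he x y h
  | refl x => exact Conn.refl _ _ _
  | symm x y _ ih => exact ih.symm
  | trans x y z _ _ ih ih' => exact ih.trans ih'

lemma Conn.mono {S T : Set β} {a b : α} (h : G.Conn S a b) (hST : S ⊆ T) : G.Conn T a b :=
  h.map id fun _ he _ _ hl => hl.conn (hST he)

lemma restrict_numComponents (G : Graph α β) (A : Set β) :
    (G.restrict A).numComponents =
      Nat.card (Quot fun x y : V(G) => ∃ e ∈ A, G.IsLink e x y) := by
  simp only [numComponents, Adj, restrict_isLink]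
  rfl

lemma mk_eq_mk_iff_conn {A : Set β} (x y : V(G)) :
    (Quot.mk (fun x y : V(G) => ∃ e ∈ A, G.IsLink e x y) x = Quot.mk _ y) ↔ G.Conn A x y := by
  constructor
  · intro h
    have h' := Quot.eqvGen_exact h
    clear h
    induction h' with
    | rel x y h => obtain ⟨e, he, h⟩ := h; exact h.conn he
    | refl x => exact Conn.refl _ _ _
    | symm x y h ih => exact ih.symm
    | trans x y z h h' ih ih' => exact ih.trans ih'
  -- `Conn` lives on all of `α`; points outside `V(G)` are related only to themselves, whence the
  -- alternative `a = b`.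
  · have key : ∀ a b, G.Conn A a b → a = b ∨ ∃ (ha : a ∈ V(G)) (hb : b ∈ V(G)),
        Quot.mk (fun x y : V(G) => ∃ e ∈ A, G.IsLink e x y) ⟨a, ha⟩ = Quot.mk _ ⟨b, hb⟩ := by
      intro a b h
      induction h with
      | rel x y h =>
        obtain ⟨e, he, h⟩ := h
        exact Or.inr ⟨h.left_mem, h.right_mem, Quot.sound ⟨e, he, h⟩⟩
      | refl x => exact Or.inl rfl
      | symm x y _ ih =>
        rcases ih with rfl | ⟨ha, hb, ih⟩
        · exact Or.inl rfl
        · exact Or.inr ⟨hb, ha, ih.symm⟩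
      | trans x y z _ _ ih ih' =>
        rcases ih with rfl | ⟨ha, hb, ih⟩
        · exact ih'
        · rcases ih' with rfl | ⟨ha', hb', ih'⟩
          · exact Or.inr ⟨ha, hb, ih⟩
          · exact Or.inr ⟨ha, hb', ih.trans ih'⟩
    intro h
    rcases key _ _ h with h | ⟨_, _, h⟩
    · rw [Subtype.ext h]
    · exact h

lemma numComponents_insert_of_conn {A : Set β} {e : β} {x y : α} (he : G.IsLink e x y)
    (h : G.Conn A x y) :
    (G.restrict (insert e A)).numComponents = (G.restrict A).numComponents := by
  rw [restrict_numComponents, restrict_numComponents]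
  refine card_quot_insert_of_eq (x := ⟨x, he.left_mem⟩) (y := ⟨y, he.right_mem⟩) ?_
    ((mk_eq_mk_iff_conn _ _).2 h)
  rintro ⟨a, ha⟩ ⟨b, hb⟩
  simp only [Set.mem_insert_iff, exists_eq_or_imp, he.isLink_iff, Subtype.mk.injEq,
    eq_comm (a := a), eq_comm (a := b)]
  rw [or_comm, and_comm (a := x = b)]

lemma numComponents_insert_of_not_conn {A : Set β} {e : β} {x y : α} (hV : V(G).Finite)
    (he : G.IsLink e x y) (h : ¬ G.Conn A x y) :
    (G.restrict (insert e A)).numComponents + 1 = (G.restrict A).numComponents := by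
  rw [restrict_numComponents, restrict_numComponents]
  have := hV.to_subtype
  refine card_quot_insert_of_ne (x := ⟨x, he.left_mem⟩) (y := ⟨y, he.right_mem⟩) ?_
    (mt (mk_eq_mk_iff_conn _ _).1 h)
  rintro ⟨a, ha⟩ ⟨b, hb⟩
  simp only [Set.mem_insert_iff, exists_eq_or_imp, he.isLink_iff, Subtype.mk.injEq,
    eq_comm (a := a), eq_comm (a := b)]
  rw [or_comm, and_comm (a := x = b)]

/-- `numComponents` depends only on the vertices and the adjacency. -/
lemma numComponents_congr {A B : Set β} (hV : V(H) = V(G))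
    (h : ∀ a b, (∃ e ∈ A, H.IsLink e a b) ↔ ∃ e ∈ B, G.IsLink e a b) :
    (H.restrict A).numComponents = (G.restrict B).numComponents := by
  rw [restrict_numComponents, restrict_numComponents]
  simp only [h]
  rw [hV]

/-- An isolated vertex is a component. -/
lemma numComponents_of_isolated {A B : Set β} {w : α} (hVG : V(G).Finite) (hw : w ∉ V(G))
    (hV : V(H) = insert w V(G))
    (h : ∀ a b, (∃ e ∈ A, H.IsLink e a b) ↔ ∃ e ∈ B, G.IsLink e a b) :
    (H.restrict A).numComponents = (G.restrict B).numComponents + 1 := by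
  classical
  rw [restrict_numComponents, restrict_numComponents]
  simp only [h]
  have := hVG.to_subtype
  rw [← Finite.card_option, hV]
  have hmem : ∀ a : ↥(insert w V(G)), a.1 ≠ w → a.1 ∈ V(G) :=
    fun a ha => a.2.resolve_left ha
  refine Nat.card_congr
    { toFun := Quot.lift (fun a => if h : a.1 = w then none
        else some (Quot.mk _ ⟨a.1, hmem a h⟩)) ?_
      invFun := fun o => o.elim (Quot.mk _ ⟨w, Set.mem_insert _ _⟩)
        (Quot.map (fun a => ⟨a.1, Set.mem_insert_of_mem _ a.2⟩) fun a b h => h)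
      left_inv := ?_
      right_inv := ?_ }
  · rintro ⟨a, ha⟩ ⟨b, hb⟩ ⟨e, he, hab⟩
    have ha' : a ≠ w := by rintro rfl; exact hw hab.left_mem
    have hb' : b ≠ w := by rintro rfl; exact hw hab.right_mem
    simp only [ha', hb', dite_false]
    rw [Quot.sound]
    exact ⟨e, he, hab⟩
  · rintro ⟨a, ha⟩
    by_cases h : a = w
    · subst h; simp
    · simp only [h, dite_false]
      rfl
  · rintro (_ | ⟨⟨a, ha⟩⟩)
    · simp
    · have ha' : a ≠ w := by rintro rfl; exact hw ha
      simp only [Option.elim, Quot.map, ha', dite_false]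

/-! ### Reduction formulas for the multivariate Tutte polynomial -/

lemma sum_powerset_insert_mul {β : Type*} [DecidableEq β] {e : β} {F : Finset β} (he : e ∉ F)
    (g : Set β → ℂ) (v : β → ℂ) :
    ∑ A ∈ (insert e F).powerset, g A * ∏ i ∈ A, v i =
      ∑ A ∈ F.powerset, (g A + v e * g (insert e (A : Set β))) * ∏ i ∈ A, v i := by
  rw [Finset.sum_powerset_insert he, ← Finset.sum_add_distrib]
  refine Finset.sum_congr rfl fun A hA => ?_
  rw [Finset.prod_insert fun h => he (Finset.mem_powerset.1 hA h), Finset.coe_insert]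
  ring

variable {α β : Type*} {G H : Graph α β} {q : ℂ} {v : β → ℂ} {e f : β} {x y w : α}

lemma multivariateTutte_eq_sum (hE : E(G).Finite) {F : Finset β} (hF : (F : Set β) = E(G)) :
    G.multivariateTutte hE q v =
      ∑ A ∈ F.powerset, q ^ (G.restrict (A : Set β)).numComponents * ∏ i ∈ A, v i := by
  have : hE.toFinset = F := by
    rw [← Finset.coe_inj, hF, Set.Finite.coe_toFinset]
  rw [multivariateTutte, this]

lemma exists_finset_erase (hE : E(G).Finite) (he : e ∈ E(G)) :
    ∃ F : Finset β, e ∉ F ∧ E(G) = insert e (F : Set β) ∧ (F : Set β) = E(G) \ {e} :=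
  ⟨(hE.subset Set.sdiff_subset : (E(G) \ {e}).Finite).toFinset, by simp, by
    simp [Set.insert_eq_of_mem he], by simp⟩

lemma multivariateTutte_eq_sum_insert (hE : E(G).Finite) {F : Finset β} (he : e ∉ F)
    (hF : E(G) = insert e (F : Set β)) :
    G.multivariateTutte hE q v = ∑ A ∈ F.powerset,
      (q ^ (G.restrict (A : Set β)).numComponents +
        v e * q ^ (G.restrict (insert e (A : Set β))).numComponents) * ∏ i ∈ A, v i := by
  classical
  rw [multivariateTutte_eq_sum hE (F := insert e F) (by simp [hF]),
    sum_powerset_insert_mul he (fun A => q ^ (G.restrict A).numComponents)]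

lemma multivariateTutte_eq_sum_insert_insert (hE : E(G).Finite) {F : Finset β} (he : e ∉ F)
    (hf : f ∉ F) (hef : e ≠ f) (hF : E(G) = insert f (insert e (F : Set β))) :
    G.multivariateTutte hE q v = ∑ A ∈ F.powerset,
      (q ^ (G.restrict (A : Set β)).numComponents +
        v f * q ^ (G.restrict (insert f (A : Set β))).numComponents +
        v e * (q ^ (G.restrict (insert e (A : Set β))).numComponents +
          v f * q ^ (G.restrict (insert f (insert e (A : Set β)))).numComponents)) *
        ∏ i ∈ A, v i := by
  classical
  rw [multivariateTutte_eq_sum hE (F := insert f (insert e F)) (by simp [hF]),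
    sum_powerset_insert_mul (by simp [hf, hef.symm])
      (fun A => q ^ (G.restrict A).numComponents),
    sum_powerset_insert_mul he (fun A => q ^ (G.restrict A).numComponents +
      v f * q ^ (G.restrict (insert f A)).numComponents)]

lemma sum_update_mul_prod {F : Finset β} [DecidableEq β] (he : e ∉ F) (g : Finset β → ℂ) (z : ℂ) :
    ∑ A ∈ F.powerset, g A * ∏ i ∈ A, Function.update v e z i =
      ∑ A ∈ F.powerset, g A * ∏ i ∈ A, v i := by
  refine Finset.sum_congr rfl fun A hA => ?_
  congr 1
  refine Finset.prod_congr rfl fun i hi => Function.update_of_ne ?_ _ _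
  rintro rfl
  exact he (Finset.mem_powerset.1 hA hi)

/-- A bridge contributes a factor `(q + v e) / q`. -/
lemma multivariateTutte_bridge [DecidableEq β] (hV : V(G).Finite) (hE : E(G).Finite)
    (he : G.IsLink e x y) (hbr : ¬ G.Conn (E(G) \ {e}) x y) :
    q * G.multivariateTutte hE q v =
      (q + v e) * G.multivariateTutte hE q (Function.update v e 0) := by
  obtain ⟨F, heF, hF, hF'⟩ := exists_finset_erase hE he.edge_mem
  rw [multivariateTutte_eq_sum_insert hE heF hF, multivariateTutte_eq_sum_insert hE heF hF,
    sum_update_mul_prod heF, Finset.mul_sum, Finset.mul_sum]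
  refine Finset.sum_congr rfl fun A hA => ?_
  have hA' : (A : Set β) ⊆ E(G) \ {e} := by
    rw [← hF']
    exact_mod_cast Finset.mem_powerset.1 hA
  rw [← numComponents_insert_of_not_conn hV he fun h => hbr (h.mono hA'), Function.update_self]
  ring

/-- Adding `e`, `f` or both to `A` joins the same two ends, so the three terms share one component
count. -/
lemma multivariateTutte_parallel [DecidableEq β] (hEG : E(G).Finite) (hEH : E(H).Finite)
    (he : e ∈ E(G)) (hf : f ∉ E(G)) (hV : V(H) = V(G))
    (hl : ∀ i a b, H.IsLink i a b ↔ G.IsLink i a b ∨ (i = f ∧ G.IsLink e a b)) :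
    H.multivariateTutte hEH q v =
      G.multivariateTutte hEG q (Function.update v e (v e + v f + v e * v f)) := by
  obtain ⟨F, heF, hF, hF'⟩ := exists_finset_erase hEG he
  have hef : e ≠ f := by rintro rfl; exact hf he
  have hfF : f ∉ F := fun h => hf (by rw [hF]; exact Or.inr h)
  have hEH' : E(H) = insert f (insert e (F : Set β)) := by
    rw [← hF]
    ext i
    simp only [edge_mem_iff_exists_isLink, hl, Set.mem_insert_iff]
    have := (G.edge_mem_iff_exists_isLink e).1 he
    by_cases hi : i = f
    · subst hi
      simp only [true_and, true_or, iff_true]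
      obtain ⟨a, b, h⟩ := this
      exact ⟨a, b, Or.inr h⟩
    · simp [hi]
  rw [multivariateTutte_eq_sum_insert hEG heF hF,
    multivariateTutte_eq_sum_insert_insert hEH heF hfF hef hEH', sum_update_mul_prod heF,
    Function.update_self]
  refine Finset.sum_congr rfl fun A hA => ?_
  have hfA : ∀ i ∈ A, i ≠ f := by
    rintro i hi rfl
    exact hfF (Finset.mem_powerset.1 hA hi)
  have hnf : ∀ a b, ¬ G.IsLink f a b := fun a b h => hf h.edge_mem
  have hA0 : ∀ a b, (∃ i ∈ (A : Set β), H.IsLink i a b) ↔ ∃ i ∈ (A : Set β), G.IsLink i a b := by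
    intro a b
    refine exists_congr fun i => and_congr_right fun hi => ?_
    simp [hl, hfA i hi]
  have e0 := numComponents_congr hV hA0
  have e1 : (H.restrict (insert e (A : Set β))).numComponents =
      (G.restrict (insert e (A : Set β))).numComponents :=
    numComponents_congr hV fun a b => by
      simp only [Set.mem_insert_iff, exists_eq_or_imp, hA0]
      simp [hl, hef]
  have e2 : (H.restrict (insert f (A : Set β))).numComponents =
      (G.restrict (insert e (A : Set β))).numComponents :=
    numComponents_congr hV fun a b => by
      simp only [Set.mem_insert_iff, exists_eq_or_imp, hA0]
      simp [hl, hnf]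
  have e3 : (H.restrict (insert f (insert e (A : Set β)))).numComponents =
      (G.restrict (insert e (A : Set β))).numComponents :=
    numComponents_congr hV fun a b => by
      simp only [Set.mem_insert_iff, exists_eq_or_imp, hA0]
      simp [hl, hnf, hef]
  rw [e0, e1, e2, e3]
  ring

/-- With neither new edge, `w` is an extra component; with exactly one, `w` is pendant; with both,
they act like `e` in `G`. Each `A` thus contributes `(q + v e + v f) * q ^ k(A) + v e * v f * q ^
k(A ∪ {e})`. -/
lemma multivariateTutte_series [DecidableEq β] (hVG : V(G).Finite) (hEG : E(G).Finite)
    (hEH : E(H).Finite) (he : G.IsLink e x y) (hf : f ∉ E(G)) (hw : w ∉ V(G))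
    (hV : V(H) = insert w V(G))
    (hl : ∀ i a b, H.IsLink i a b ↔
      (i ≠ e ∧ G.IsLink i a b) ∨ (i = e ∧ s(a, b) = s(x, w)) ∨ (i = f ∧ s(a, b) = s(w, y)))
    (h0 : q + v e + v f ≠ 0) :
    H.multivariateTutte hEH q v = (q + v e + v f) *
      G.multivariateTutte hEG q (Function.update v e (v e * v f / (q + v e + v f))) := by
  obtain ⟨F, heF, hF, hF'⟩ := exists_finset_erase hEG he.edge_mem
  have hef : e ≠ f := by rintro rfl; exact hf he.edge_mem
  have hfF : f ∉ F := fun h => hf (by rw [hF]; exact Or.inr h)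
  have hnf : ∀ a b, ¬ G.IsLink f a b := fun a b h => hf h.edge_mem
  have hle : H.IsLink e x w := (hl _ _ _).2 (by simp)
  have hlf : H.IsLink f w y := (hl _ _ _).2 (by simp)
  have hEH' : E(H) = insert f (insert e (F : Set β)) := by
    rw [← hF]
    ext i
    by_cases hie : i = e
    · subst hie
      simp [hle.edge_mem, he.edge_mem]
    by_cases hif : i = f
    · subst hif
      simp [hlf.edge_mem]
    simp [edge_mem_iff_exists_isLink, hl, hie, hif]
  have hVH : V(H).Finite := by rw [hV]; exact hVG.insert w
  have hwx : w ≠ x := by rintro rfl; exact hw he.left_mem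
  have hwy : w ≠ y := by rintro rfl; exact hw he.right_mem
  rw [multivariateTutte_eq_sum_insert hEG heF hF,
    multivariateTutte_eq_sum_insert_insert hEH heF hfF hef hEH', sum_update_mul_prod heF,
    Function.update_self, Finset.mul_sum]
  refine Finset.sum_congr rfl fun A hA => ?_
  have hAe : ∀ i ∈ A, i ≠ e := by
    rintro i hi rfl
    exact heF (Finset.mem_powerset.1 hA hi)
  have hAf : ∀ i ∈ A, i ≠ f := by
    rintro i hi rfl
    exact hfF (Finset.mem_powerset.1 hA hi)
  have hlA : ∀ i ∈ A, ∀ a b, H.IsLink i a b ↔ G.IsLink i a b := fun i hi a b => by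
    simp [hl, hAe i hi, hAf i hi]
  have hA0 : ∀ a b, (∃ i ∈ (A : Set β), H.IsLink i a b) ↔ ∃ i ∈ (A : Set β), G.IsLink i a b :=
    fun a b => exists_congr fun i => and_congr_right fun hi => hlA i hi a b
  have e0 := numComponents_of_isolated hVG hw hV hA0
  have hiso : ∀ z, H.Conn A z w → z = w := by
    have key : ∀ a b, H.Conn A a b → (a = w ↔ b = w) := by
      intro a b h
      induction h with
      | rel a b h =>
        obtain ⟨i, hi, h⟩ := h
        rw [hlA i hi] at h
        have ha : a ≠ w := by rintro rfl; exact hw h.left_mem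
        have hb : b ≠ w := by rintro rfl; exact hw h.right_mem
        simp [ha, hb]
      | refl a => rfl
      | symm a b _ ih => exact ih.symm
      | trans a b c _ _ ih ih' => exact ih.trans ih'
    exact fun z hz => (key z w hz).2 rfl
  have e1 := numComponents_insert_of_not_conn hVH hle fun h => hwx (hiso _ h).symm
  have e2 := numComponents_insert_of_not_conn hVH hlf.symm fun h => hwy (hiso _ h).symm
  have hcon : H.Conn (insert e (A : Set β)) w y ↔ G.Conn A x y := by
    classical
    constructor
    · intro h
      -- Contracting the edge `e` of `H` sends `w` to `x`.
      have := h.map (H := G) (T := A) (fun a => if a = w then x else a) ?_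
      · simpa [hwy.symm] using this
      · rintro i (rfl | hi) a b hab
        · rw [hle.isLink_iff] at hab
          rcases hab with ⟨rfl, rfl⟩ | ⟨rfl, rfl⟩ <;> simpa using Conn.refl _ _ _
        · rw [hlA i hi] at hab
          have ha : a ≠ w := by rintro rfl; exact hw hab.left_mem
          have hb : b ≠ w := by rintro rfl; exact hw hab.right_mem
          simpa [ha, hb] using hab.conn hi
    · intro h
      refine (hle.symm.conn (Set.mem_insert _ _)).trans (h.map id fun i hi a b hab => ?_)
      exact ((hlA i hi a b).2 hab).conn (Set.mem_insert_of_mem _ hi)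
  have e3 : (H.restrict (insert f (insert e (A : Set β)))).numComponents =
      (G.restrict (insert e (A : Set β))).numComponents := by
    by_cases h : G.Conn A x y
    · rw [numComponents_insert_of_conn hlf (hcon.2 h), numComponents_insert_of_conn he h]
      omega
    · have h1 := numComponents_insert_of_not_conn hVH hlf (mt hcon.1 h)
      have h2 := numComponents_insert_of_not_conn hVG he h
      omega
  have e1' : (H.restrict (insert e (A : Set β))).numComponents =
    (G.restrict (A : Set β)).numComponents := by omega
  have e2' : (H.restrict (insert f (A : Set β))).numComponents =
    (G.restrict (A : Set β)).numComponents := by omega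
  rw [e0, e1', e2', e3]
  field_simp
  ring

/-! ### Walks, paths and flows -/

section Walk

variable {α β : Type*} {G : Graph α β} {x y z u : α} {e : β} {p : List (β × α)} {S : Set β}

lemma IsWalk.exists_suffix (h : G.IsWalk x p y) (hp : (x :: walkTail p).Nodup)
    (hu : u ∈ x :: walkTail p) : ∃ p', G.IsPath u p' y ∧ ∀ e ∈ walkEdges p', e ∈ walkEdges p := by
  induction h with
  | @nil x hx =>
    obtain rfl : u = x := by simpa [walkTail] using hu
    exact ⟨[], ⟨.nil hx, hp⟩, fun _ h => h⟩
  | @cons x z y e p h hw ih =>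
    rcases List.mem_cons.1 hu with rfl | hu
    · exact ⟨_, ⟨.cons h hw, hp⟩, fun _ h => h⟩
    · obtain ⟨p', hp', hs⟩ := ih (List.nodup_cons.1 hp).2 hu
      exact ⟨p', hp', fun i hi => List.mem_cons_of_mem _ (hs i hi)⟩

lemma Conn.exists_isPath (h : G.Conn S x y) (hy : y ∈ V(G)) :
    ∃ p, G.IsPath x p y ∧ ∀ e ∈ walkEdges p, e ∈ S := by
  have : Std.Symm fun a b => ∃ e ∈ S, G.IsLink e a b :=
    ⟨fun a b ⟨e, he, h⟩ => ⟨e, he, h.symm⟩⟩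
  rw [Conn, Relation.EqvGen.eqvGen_eq_reflTransGen] at h
  induction h using Relation.ReflTransGen.head_induction_on with
  | refl => exact ⟨[], ⟨.nil hy, by simp [walkTail]⟩, by simp [walkEdges]⟩
  | @head a c hac _ ih =>
    obtain ⟨e, he, hac⟩ := hac
    obtain ⟨p, ⟨hp, hnd⟩, hS⟩ := ih
    -- If the path already visits `a`, its part from `a` onwards is used instead.
    by_cases ha : a ∈ c :: walkTail p
    · obtain ⟨p', hp', hs⟩ := hp.exists_suffix hnd ha
      exact ⟨p', hp', fun i hi => hS i (hs i hi)⟩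
    · refine ⟨(e, c) :: p, ⟨.cons hac hp, List.nodup_cons.2 ⟨ha, hnd⟩⟩, fun i hi => ?_⟩
      rcases List.mem_cons.1 hi with rfl | hi
      · exact he
      · exact hS i hi

lemma IsWalk.mem_of_isLink (h : G.IsWalk x p y) (he : e ∈ walkEdges p) (hl : G.IsLink e u z) :
    u ∈ x :: walkTail p := by
  induction h with
  | nil => simp [walkEdges] at he
  | @cons x w y i p h hw ih =>
    rcases List.mem_cons.1 he with rfl | he
    · rcases hl.left_eq_or_eq h with rfl | rfl
      · simp
      · simp [walkTail]
    · exact List.mem_cons_of_mem _ (ih he)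

lemma IsWalk.nodup_walkEdges (h : G.IsWalk x p y) (hp : (x :: walkTail p).Nodup) :
    (walkEdges p).Nodup := by
  induction h with
  | nil => simp [walkEdges]
  | @cons x w y i p h hw ih =>
    obtain ⟨hx, hp⟩ := List.nodup_cons.1 hp
    exact List.nodup_cons.2 ⟨fun hi => hx (hw.mem_of_isLink hi h), ih hp⟩

/-- Every edge of a forest is a bridge. -/
lemma IsForest.not_conn (hG : G.IsForest) (he : G.IsLink e x y) :
    ¬ G.Conn (E(G) \ {e}) x y := by
  intro h
  obtain ⟨p, ⟨hp, hnd⟩, hS⟩ := h.exists_isPath he.right_mem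
  refine hG y ((e, x) :: p) ⟨.cons he.symm hp, by simp, ?_, hnd⟩
  exact List.nodup_cons.2 ⟨fun h => (hS e h).2 rfl, hp.nodup_walkEdges hnd⟩

/-- Every connecting edge set contains a path, so disjoint connecting sets can replace edge-disjoint
paths and no walks need be concatenated. -/
lemma le_of_maxMaxFlow_le {Λ k : ℕ} (hflow : G.maxMaxFlow ≤ Λ) (hx : x ∈ V(G)) (hy : y ∈ V(G))
    (hxy : x ≠ y) (T : Fin k → Set β) (hT : ∀ i, G.Conn (T i) x y)
    (hd : ∀ i j, i ≠ j → Disjoint (T i) (T j)) : k ≤ Λ := by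
  choose P hP hPT using fun i => (hT i).exists_isPath hy
  have h1 : (k : ℕ∞) ≤ G.maxFlow x y := by
    refine le_iSup₂_of_le (f := fun (k : ℕ) _ => (k : ℕ∞)) k ⟨P, hP, fun i j hij => ?_⟩ le_rfl
    intro e he he'
    exact Set.disjoint_left.1 (hd i j hij) (hPT i e he) (hPT j e he')
  have h2 : G.maxFlow x y ≤ G.maxMaxFlow :=
    le_iSup₂_of_le x hx (le_iSup₂_of_le y hy (le_iSup_of_le hxy le_rfl))
  exact_mod_cast h1.trans (h2.trans hflow)

lemma FromForest.not_isLink_self (hG : G.FromForest) (e : β) (x : α) : ¬ G.IsLink e x x := by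
  induction hG generalizing e x with
  | forest hG => exact fun h => hG.not_conn h (Conn.refl _ _ _)
  | parallel _ h ih =>
    obtain ⟨i, _, f, _, _, hl⟩ := h
    rw [hl]
    rintro (h | ⟨_, h⟩) <;> exact ih _ _ h
  | series _ h ih =>
    obtain ⟨i, a, b, hi, f, _, w, hw, _, hl⟩ := h
    have ha : a ≠ w := by rintro rfl; exact hw hi.left_mem
    have hb : b ≠ w := by rintro rfl; exact hw hi.right_mem
    rw [hl]
    rintro (⟨_, h⟩ | ⟨_, h⟩ | ⟨_, h⟩)
    · exact ih _ _ h
    all_goals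
      rw [Sym2.eq_iff] at h
      grind

end Walk

/-! ### Realising a reduced graph inside the original one -/

/-- Each edge `e` of `G` is carried by `c e` edge sets `W e 0, W e 1, …` of `K` which join its ends;
all these sets are disjoint. -/
structure CarriedBy {α β : Type*} (G K : Graph α β) (c : β → ℕ) (W : β → ℕ → Set β) : Prop where
  subset : V(G) ⊆ V(K)
  conn : ∀ e a b, G.IsLink e a b → ∀ i < c e, K.Conn (W e i) a b
  disjoint : ∀ e ∈ E(G), ∀ e' ∈ E(G), ∀ i < c e, ∀ j < c e', (e = e' → i ≠ j) →
    Disjoint (W e i) (W e' j)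

section Carried

variable {α β : Type*} {G H K : Graph α β} {c c' : β → ℕ} {W : β → ℕ → Set β} {e f : β} {x y w : α}

lemma CarriedBy.mono (h : G.CarriedBy K c W) (hc : ∀ e, c' e ≤ c e) : G.CarriedBy K c' W where
  subset := h.subset
  conn e a b hl i hi := h.conn e a b hl i (hi.trans_le (hc e))
  disjoint e he e' he' i hi j hj :=
    h.disjoint e he e' he' i (hi.trans_le (hc e)) j (hj.trans_le (hc e'))

/-- An edge which exhausts the flow is a bridge. -/
lemma CarriedBy.not_conn (h : G.CarriedBy K c W) {Λ : ℕ} (hflow : K.maxMaxFlow ≤ Λ)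
    (hc : ∀ e ∈ E(G), 1 ≤ c e) (he : G.IsLink e x y) (hxy : x ≠ y) (hce : Λ ≤ c e) :
    ¬ G.Conn (E(G) \ {e}) x y := by
  intro hcon
  -- One carrier per other edge suffices to lift a detour around `e` to `K`; it is disjoint from all
  -- carriers of `e`.
  have hU : K.Conn (⋃ i ∈ E(G) \ {e}, W i 0) x y := by
    refine hcon.map id fun i hi a b hab => ?_
    refine (h.conn i a b hab 0 (hc i hi.1)).mono ?_
    exact Set.subset_biUnion_of_mem (u := fun i => W i 0) hi
  have hWU : ∀ i < c e, Disjoint (W e i) (⋃ i ∈ E(G) \ {e}, W i 0) := by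
    intro i hi
    rw [Set.disjoint_iUnion₂_right]
    intro j hj
    exact h.disjoint e he.edge_mem j hj.1 i hi 0 (hc j hj.1) fun h => absurd h.symm hj.2
  have := le_of_maxMaxFlow_le (k := c e + 1) hflow (h.subset he.left_mem) (h.subset he.right_mem)
    hxy (fun i => if i.1 < c e then W e i else ⋃ i ∈ E(G) \ {e}, W i 0) ?_ ?_
  · omega
  · intro i
    split_ifs with hi
    · exact h.conn e x y he i hi
    · exact hU
  · intro i j hij
    have hij' : i.1 ≠ j.1 := fun h => hij (Fin.ext h)
    split_ifs with hi hj hj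
    · exact h.disjoint e he.edge_mem e he.edge_mem i hi j hj fun _ => hij'
    · exact hWU i hi
    · exact (hWU j hj).symm
    · omega

/-- The carriers of `f` are appended to those of `e`, hence the index shift. -/
lemma CarriedBy.parallel [DecidableEq β] (h : H.CarriedBy K c W) (he : e ∈ E(G)) (hf : f ∉ E(G))
    (hV : V(H) = V(G))
    (hl : ∀ i a b, H.IsLink i a b ↔ G.IsLink i a b ∨ (i = f ∧ G.IsLink e a b)) :
    G.CarriedBy K (Function.update c e (c e + c f))
      (Function.update W e fun i => if i < c e then W e i else W f (i - c e)) := by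
  have hE : ∀ i ∈ E(G), i ∈ E(H) := by
    intro i hi
    obtain ⟨a, b, hab⟩ := exists_isLink_of_mem_edgeSet hi
    exact ((hl _ _ _).2 (Or.inl hab)).edge_mem
  have hfH : f ∈ E(H) := by
    obtain ⟨a, b, hab⟩ := exists_isLink_of_mem_edgeSet he
    exact ((hl _ _ _).2 (Or.inr ⟨rfl, hab⟩)).edge_mem
  have hne : ∀ i ∈ E(G), i ≠ f := by rintro i hi rfl; exact hf hi
  refine ⟨hV ▸ h.subset, ?_, ?_⟩
  · intro j a b hab i hi
    by_cases hj : j = e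
    · subst hj
      simp only [Function.update_self] at hi ⊢
      split_ifs with hi'
      · exact h.conn j a b ((hl _ _ _).2 (Or.inl hab)) i hi'
      · exact h.conn f a b ((hl _ _ _).2 (Or.inr ⟨rfl, hab⟩)) _ (by omega)
    · simp only [Function.update_of_ne hj] at hi ⊢
      exact h.conn j a b ((hl _ _ _).2 (Or.inl hab)) i hi
  · have key : ∀ j ∈ E(G), j ≠ e → ∀ i < c e + c f, ∀ k < c j,
        Disjoint (if i < c e then W e i else W f (i - c e)) (W j k) := by
      intro j hj hje i hi k hk
      split_ifs with hi'
      · exact h.disjoint e (hE e he) j (hE j hj) i hi' k hk fun h => absurd h.symm hje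
      · exact h.disjoint f hfH j (hE j hj) _ (by omega) k hk fun h => absurd h.symm (hne j hj)
    intro j hj j' hj' i hi i' hi' hne'
    by_cases hje : j = e <;> by_cases hje' : j' = e
    · subst hje hje'
      have hii := hne' rfl
      simp only [Function.update_self] at hi hi' ⊢
      split_ifs with h1 h2 h2
      · exact h.disjoint _ (hE _ hj) _ (hE _ hj) i h1 i' h2 fun _ => hii
      · exact h.disjoint _ (hE _ hj) f hfH i h1 _ (by omega) fun h => absurd h (hne _ hj)
      · exact h.disjoint f hfH _ (hE _ hj) _ (by omega) i' h2 fun h => absurd h.symm (hne _ hj)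
      · exact h.disjoint f hfH f hfH _ (by omega) _ (by omega) fun _ => by omega
    · subst hje
      simp only [Function.update_self, Function.update_of_ne hje'] at hi hi' ⊢
      exact key j' hj' hje' i hi i' hi'
    · subst hje'
      simp only [Function.update_self, Function.update_of_ne hje] at hi hi' ⊢
      exact (key j hj hje i' hi' i hi).symm
    · simp only [Function.update_of_ne hje, Function.update_of_ne hje'] at hi hi' ⊢
      exact h.disjoint j (hE j hj) j' (hE j' hj') i hi i' hi' hne'

/-- Carriers of `e` and `f` are joined in pairs through `w`; unpaired ones are dropped. -/
lemma CarriedBy.series [DecidableEq β] (h : H.CarriedBy K c W) (he : G.IsLink e x y)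
    (hf : f ∉ E(G)) (hV : V(H) = insert w V(G))
    (hl : ∀ i a b, H.IsLink i a b ↔
      (i ≠ e ∧ G.IsLink i a b) ∨ (i = e ∧ s(a, b) = s(x, w)) ∨ (i = f ∧ s(a, b) = s(w, y))) :
    G.CarriedBy K (Function.update c e (min (c e) (c f)))
      (Function.update W e fun i => W e i ∪ W f i) := by
  have hle : H.IsLink e x w := (hl _ _ _).2 (by simp)
  have hlf : H.IsLink f w y := (hl _ _ _).2 (by simp)
  have hE : ∀ i ∈ E(G), i ∈ E(H) := by
    intro i hi
    by_cases hie : i = e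
    · exact hie ▸ hle.edge_mem
    obtain ⟨a, b, hab⟩ := exists_isLink_of_mem_edgeSet hi
    exact ((hl _ _ _).2 (Or.inl ⟨hie, hab⟩)).edge_mem
  have hne : ∀ i ∈ E(G), i ≠ f := by rintro i hi rfl; exact hf hi
  have hef := hne e he.edge_mem
  refine ⟨fun a ha => h.subset (hV ▸ Set.mem_insert_of_mem _ ha), ?_, ?_⟩
  · intro j a b hab i hi
    by_cases hj : j = e
    · subst hj
      simp only [Function.update_self, lt_min_iff] at hi ⊢
      have hxy : K.Conn (W j i ∪ W f i) x y :=
        ((h.conn j x w hle i hi.1).mono Set.subset_union_left).trans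
          ((h.conn f w y hlf i hi.2).mono Set.subset_union_right)
      rcases he.eq_and_eq_or_eq_and_eq hab with ⟨rfl, rfl⟩ | ⟨rfl, rfl⟩
      · exact hxy
      · exact hxy.symm
    · simp only [Function.update_of_ne hj] at hi ⊢
      exact h.conn j a b ((hl _ _ _).2 (Or.inl ⟨hj, hab⟩)) i hi
  · have key : ∀ j ∈ E(G), j ≠ e → ∀ i < min (c e) (c f), ∀ k < c j,
        Disjoint (W e i ∪ W f i) (W j k) := by
      intro j hj hje i hi k hk
      rw [lt_min_iff] at hi
      rw [Set.disjoint_union_left]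
      exact ⟨h.disjoint e hle.edge_mem j (hE j hj) i hi.1 k hk fun h => absurd h.symm hje,
        h.disjoint f hlf.edge_mem j (hE j hj) i hi.2 k hk fun h => absurd h.symm (hne j hj)⟩
    intro j hj j' hj' i hi i' hi' hne'
    by_cases hje : j = e <;> by_cases hje' : j' = e
    · subst hje hje'
      have hii := hne' rfl
      simp only [Function.update_self, lt_min_iff] at hi hi' ⊢
      rw [Set.disjoint_union_left, Set.disjoint_union_right, Set.disjoint_union_right]
      exact ⟨⟨h.disjoint _ hle.edge_mem _ hle.edge_mem i hi.1 i' hi'.1 fun _ => hii,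
        h.disjoint _ hle.edge_mem _ hlf.edge_mem i hi.1 i' hi'.2 fun h => absurd h hef⟩,
        h.disjoint _ hlf.edge_mem _ hle.edge_mem i hi.2 i' hi'.1 fun h => absurd h.symm hef,
        h.disjoint _ hlf.edge_mem _ hlf.edge_mem i hi.2 i' hi'.2 fun _ => hii⟩
    · subst hje
      simp only [Function.update_self, Function.update_of_ne hje'] at hi hi' ⊢
      exact key j' hj' hje' i hi i' hi'
    · subst hje'
      simp only [Function.update_self, Function.update_of_ne hje] at hi hi' ⊢
      exact (key j hj hje i' hi' i hi).symm
    · simp only [Function.update_of_ne hje, Function.update_of_ne hje'] at hi hi' ⊢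
      exact h.disjoint j (hE j hj) j' (hE j' hj') i hi i' hi' hne'

end Carried

/-! ### Non-vanishing -/

section Nonvanishing

variable {α β : Type*} {G K : Graph α β} {q : ℂ}

lemma IsForest.multivariateTutte_ne_zero (hG : G.IsForest) (hV : V(G).Finite) (hE : E(G).Finite)
    (hq : q ≠ 0) (v : β → ℂ) (hv : ∀ e ∈ E(G), q + v e ≠ 0) :
    G.multivariateTutte hE q v ≠ 0 := by
  classical
  -- The graph stays fixed; bridges are given weight `0` one by one, and `F` contains the edges not
  -- yet treated. In the end only `A = ∅` contributes.
  suffices ∀ F : Finset β, ∀ v : β → ℂ, (∀ e ∈ E(G), q + v e ≠ 0) →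
      (∀ e ∈ E(G), e ∉ F → v e = 0) → G.multivariateTutte hE q v ≠ 0 from
    this hE.toFinset v hv (by simp +contextual)
  intro F
  induction F using Finset.induction_on with
  | empty =>
    intro v _ h0
    rw [multivariateTutte, Finset.sum_eq_single ∅]
    · simp [hq]
    · intro A hA hne
      obtain ⟨i, hi⟩ := Finset.nonempty_iff_ne_empty.2 hne
      have hiE : i ∈ E(G) := by simpa using Finset.mem_powerset.1 hA hi
      rw [Finset.prod_eq_zero hi (h0 i hiE (by simp)), mul_zero]
    · simp
  | insert e F _ ih =>
    intro v hv h0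
    by_cases he : e ∈ E(G)
    · obtain ⟨x, y, hxy⟩ := exists_isLink_of_mem_edgeSet he
      have hb := multivariateTutte_bridge (q := q) (v := v) hV hE hxy (hG.not_conn hxy)
      have hne := ih (Function.update v e 0) (fun i hi => ?_) fun i hi hiF => ?_
      · exact right_ne_zero_of_mul (hb.trans_ne (mul_ne_zero (hv e he) hne))
      · by_cases hie : i = e
        · simpa [hie] using hq
        · simpa [hie] using hv i hi
      · by_cases hie : i = e
        · simp [hie]
        · simpa [hie] using h0 i hi (by simp [hie, hiF])
    · refine ih v hv fun i hi hiF => h0 i hi ?_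
      rintro hiF'
      rcases Finset.mem_insert.1 hiF' with rfl | h
      exacts [he hi, hiF h]

/-- `K` is the original graph and stays fixed while `G` is reduced, so the flow bound is never
transferred to reduced graphs. -/
theorem FromForest.multivariateTutte_ne_zero (hG : G.FromForest) (hq : 1 < ‖q - 1‖) {m : ℕ}
    (hm1 : 1 ≤ m) (hm : growth ‖q - 1‖⁻¹ ^ m * (1 + ‖q - 1‖⁻¹) ≤ 2)
    (hflow : K.maxMaxFlow ≤ (m + 1 : ℕ)) (hV : V(G).Finite) (hE : E(G).Finite)
    (c : β → ℕ) (W : β → ℕ → Set β) (v : β → ℂ) (hcar : G.CarriedBy K c W)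
    (hv : ∀ e ∈ E(G), 1 ≤ c e ∧ c e ≤ m ∧ v e ∈ weightRegion q (c e)) :
    G.multivariateTutte hE q v ≠ 0 := by
  classical
  have hr0 : 0 < ‖q - 1‖⁻¹ := by positivity
  have hr1 : ‖q - 1‖⁻¹ < 1 := inv_lt_one_of_one_lt₀ hq
  have hq0 : q ≠ 0 := by rintro rfl; simp at hq
  have hdisc : ∀ {k : ℕ} {u : ℂ}, k ≤ m → u ∈ weightRegion q k → u ∈ weightDisc q :=
    fun hk hu => mem_weightDisc_of_mem_weightRegion hq (growth_pow_anti hr0 hr1 hk hm) hu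
  induction hG generalizing c W v with
  | forest hG =>
    exact hG.multivariateTutte_ne_zero hV hE hq0 v fun e he =>
      add_ne_zero_of_mem_weightDisc hq (hdisc (hv e he).2.1 (hv e he).2.2)
  | @parallel G H hG h ih =>
    obtain ⟨e, he, f, hf, hVH, hl⟩ := h
    have hVG : V(G).Finite := hVH ▸ hV
    have hEsub : ∀ i ∈ E(G), i ∈ E(H) := fun i hi => by
      obtain ⟨a, b, hab⟩ := exists_isLink_of_mem_edgeSet hi
      exact ((hl _ _ _).2 (Or.inl hab)).edge_mem
    have hEG : E(G).Finite := hE.subset hEsub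
    obtain ⟨x, y, hxy⟩ := exists_isLink_of_mem_edgeSet he
    have hfH : f ∈ E(H) := ((hl _ _ _).2 (Or.inr ⟨rfl, hxy⟩)).edge_mem
    have hcar' := hcar.parallel he hf hVH hl
    obtain ⟨he1, he2, he3⟩ := hv e (hEsub e he)
    obtain ⟨hf1, hf2, hf3⟩ := hv f hfH
    rw [multivariateTutte_parallel hEG hE he hf hVH hl]
    by_cases hef : c e + c f ≤ m
    · refine ih hVG hEG _ _ _ hcar' fun i hi => ?_
      by_cases hie : i = e
      · subst hie
        simp only [Function.update_self]
        exact ⟨by omega, hef, parallel_mem hq (growth_pow_anti hr0 hr1 hef hm) he3 hf3⟩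
      · simpa only [Function.update_of_ne hie] using hv i (hEsub i hi)
    -- Here `c e + c f ≥ m + 1`, the flow bound, so the merged edge is a bridge.
    · have hne : x ≠ y := by rintro rfl; exact hG.not_isLink_self _ _ hxy
      have hbr := hcar'.not_conn hflow (fun i hi => ?_) hxy hne (by
        rw [Function.update_self]; omega)
      · have hb := multivariateTutte_bridge (q := q)
          (v := Function.update v e (v e + v f + v e * v f)) hVG hEG hxy hbr
        refine right_ne_zero_of_mul (hb.trans_ne (mul_ne_zero ?_ ?_))
        · rw [Function.update_self]
          exact add_add_mul_ne_zero hq (hdisc he2 he3) (hdisc hf2 hf3)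
        -- The bridge stays with weight `0`, which lies in every region. Its multiplicity becomes
        -- `1`, not `0`, because `CarriedBy.not_conn` needs a carrier for each edge.
        · refine ih hVG hEG (Function.update c e 1) _ _ (hcar'.mono fun i => ?_) fun i hi => ?_
          · by_cases hie : i = e
            · subst hie
              simp only [Function.update_self]
              omega
            · simp only [Function.update_of_ne hie, le_refl]
          · by_cases hie : i = e
            · subst hie
              simp only [Function.update_self]
              refine ⟨le_rfl, hm1, ?_⟩
              have := mem_weightRegion_of_mem_Icc (x := 0) hq
                (growth_pow_anti hr0 hr1 hm1 hm) (by simp)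
              simpa using this
            · simpa only [Function.update_of_ne hie] using hv i (hEsub i hi)
      · by_cases hie : i = e
        · subst hie
          simp only [Function.update_self]
          omega
        · simpa only [Function.update_of_ne hie] using (hv i (hEsub i hi)).1
  | @series G H hG h ih =>
    obtain ⟨e, x, y, he, f, hf, w, hw, hVH, hl⟩ := h
    have hVG : V(G).Finite := hV.subset (by rw [hVH]; exact Set.subset_insert _ _)
    have hle : H.IsLink e x w := (hl _ _ _).2 (by simp)
    have hlf : H.IsLink f w y := (hl _ _ _).2 (by simp)
    have hEsub : ∀ i ∈ E(G), i ∈ E(H) := fun i hi => by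
      by_cases hie : i = e
      · exact hie ▸ hle.edge_mem
      obtain ⟨a, b, hab⟩ := exists_isLink_of_mem_edgeSet hi
      exact ((hl _ _ _).2 (Or.inl ⟨hie, hab⟩)).edge_mem
    have hEG : E(G).Finite := hE.subset hEsub
    obtain ⟨he1, he2, he3⟩ := hv e hle.edge_mem
    obtain ⟨hf1, hf2, hf3⟩ := hv f hlf.edge_mem
    have hmin : min (c e) (c f) ≤ m := (min_le_left _ _).trans he2
    obtain ⟨h0, hser⟩ := series_mem hq (growth_pow_anti hr0 hr1 hmin hm) (le_min he1 hf1)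
      (hdisc he2 he3) (hdisc hf2 hf3)
    rw [multivariateTutte_series hVG hEG hE he hf hw hVH hl h0]
    refine mul_ne_zero h0 (ih hVG hEG _ _ _ (hcar.series he hf hVH hl) fun i hi => ?_)
    by_cases hie : i = e
    · subst hie
      simp only [Function.update_self]
      exact ⟨le_min he1 hf1, hmin, hser⟩
    · simpa only [Function.update_of_ne hie] using hv i (hEsub i hi)

end Nonvanishing

end Graph

theorem theorem1p5 {α β : Type*} (Λ : ℕ) (hΛ : 2 ≤ Λ) (G : Graph α β)
    (hV : V(G).Finite) (hE : E(G).Finite) (hloopless : G.Loopless)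
    (hsp : G.IsSeriesParallel) (hflow : G.maxMaxFlow ≤ (Λ : ℕ∞))
    (v : β → ℝ) (hv : ∀ e ∈ E(G), v e ∈ Set.Icc (-1 : ℝ) 0)
    (q : ℂ) (hq : G.multivariateTutte hE q (fun e => (v e : ℂ)) = 0) :
    ‖q - 1‖ < ((Λ : ℝ) - 1) / Real.log 2 := by
  by_contra! hlt
  obtain ⟨m, rfl⟩ : ∃ m, Λ = m + 1 := ⟨Λ - 1, by omega⟩
  have hm1 : 1 ≤ m := by omega
  have hl1 := Real.log_two_gt_d9
  have hl2 := Real.log_two_lt_d9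
  have hmR : (1 : ℝ) ≤ m := by exact_mod_cast hm1
  push_cast at hlt
  rw [add_sub_cancel_right, div_le_iff₀ (by linarith)] at hlt
  have hq1 : 1 < ‖q - 1‖ := by nlinarith
  have hq0 : 0 < ‖q - 1‖ := by linarith
  have hgr := Graph.growth_pow_bound (r := ‖q - 1‖⁻¹) (by positivity) hm1 (by
    rw [inv_mul_le_iff₀ hq0]
    exact hlt)
  have hF : G.FromForest := by
    have hloops : {e | ∃ x, G.IsLoopAt e x} = ∅ := by
      ext e
      simp
    rwa [Graph.IsSeriesParallel, hloops, Graph.deleteEdges_empty] at hsp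
  -- Initially `K = G` and each edge is its own single carrier.
  refine hF.multivariateTutte_ne_zero hq1 hm1 hgr hflow hV hE (fun _ => 1) (fun e _ => {e})
    (fun e => (v e : ℂ)) ⟨subset_rfl, ?_, ?_⟩ ?_ hq
  · exact fun e a b hab i _ => hab.conn rfl
  · intro e _ e' _ i hi j hj hne
    rw [Set.disjoint_singleton]
    rintro rfl
    exact hne rfl (by omega)
  · intro e he
    exact ⟨le_rfl, hm1, Graph.mem_weightRegion_of_mem_Icc hq1 (Graph.growth_pow_anti
      (by positivity) (inv_lt_one_of_one_lt₀ hq1) hm1 hgr) (hv e he)⟩
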